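/- Let $X$ be a complex Banach space with topological dual $X^*$, and let $T$ be a bounded linear operator on $X$ with $r(T)=\|T\|=1$, where $r(T)$ is the spectral radius, and with $\sigma(T)\subset\{z\in\mathbb C:|z|<1\}\cup\{1\}$. Let $T^*:X^*\to X^*$, $T^*f=f\circ T$, be the adjoint of $T$. A bounded operator is called a Weyl operator if it is Fredholm of index $0$; the essential spectrum of $T$ is $\sigma_{ess}(T)=\{\lambda\in\mathbb C: T-\lambda I\text{ is not a Weyl operator}\}$, and $T$ is called quasi-compact if its essential spectral radius $r_{ess}(T)=\sup\{|\lambda|:\lambda\in\sigma_{ess}(T)\}$ (with $\sup\emptyset=0$) is less than $1$. (a) $T$ is quasi-compact if and only if there is a bounded finite-rank projection $P$ on $X$ with $TP=PT=P$ and $$\lim_{m\to\infty}\|T^m-P\|=0 .$$ (b) If $T$ is quasi-compact, then $\ker(T-I)$ and $\ker(T^*-I)$ are finite-dimensional of the same dimension, and for every basis $e_1,\dots,e_n$ of $\ker(T-I)$ and every basis $e_1^*,\dots,e_n^*$ of $\ker(T^*-I)$ the Gram matrix $G=(e_i^*(e_j))_{i,j=1}^n$ is invertible, and the operator $$Px=\Phi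 G^{-1}\Phi^* x=\sum_{i=1}^n\sum_{j=1}^n (G^{-1})_{ij}\,e_j^*(x)\,e_i ,\qquad x\in X,$$ where $\Phi:\mathbb C^n\to X$, $\Phi(a)=\sum_i a_ie_i$, and $\Phi^*:X\to\mathbb C^n$, $\Phi^*x=(e_1^*(x),\dots,e_n^*(x))$, is a finite-rank projection onto $\ker(T-I)$ with $TP=PT=P$ and $\lim_{m\to\infty}\|T^m-P\|=0$. -/

import Mathlib

open Filter Topology

/-- A bounded operator is a Weyl operator if it is Fredholm of index zero
(`LinearMap.index` is `dim ker - dim coker`). -/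
def IsWeylOperator {X : Type*} [NormedAddCommGroup X] [NormedSpace ℂ X] (T : X →L[ℂ] X) : Prop :=
  T.IsFredholm ∧ (T : X →ₗ[ℂ] X).index = 0

/-- The essential (Weyl) spectrum: all `z` such that `T - z I` is not a Weyl operator. -/
def essentialSpectrum {X : Type*} [NormedAddCommGroup X] [NormedSpace ℂ X] (T : X →L[ℂ] X) :
    Set ℂ :=
  {z | ¬ IsWeylOperator (T - z • ContinuousLinearMap.id ℂ X)}

/-- The essential spectral radius, `sup {|z| : z ∈ σ_ess(T)}` (zero if `σ_ess(T)` is empty). -/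
noncomputable def essentialSpectralRadius {X : Type*} [NormedAddCommGroup X] [NormedSpace ℂ X]
    (T : X →L[ℂ] X) : ENNReal :=
  ⨆ z ∈ essentialSpectrum T, (‖z‖₊ : ENNReal)

/-- `T` is quasi-compact if its essential spectral radius is less than one. -/
def IsQuasiCompactOperator {X : Type*} [NormedAddCommGroup X] [NormedSpace ℂ X]
    (T : X →L[ℂ] X) : Prop :=
  essentialSpectralRadius T < 1

/-- The Banach space adjoint `T* : X* → X*`, `T* f = f ∘ T`. -/
noncomputable def dualAdjoint {X : Type*} [NormedAddCommGroup X] [NormedSpace ℂ X]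
    (T : X →L[ℂ] X) : StrongDual ℂ X →L[ℂ] StrongDual ℂ X :=
  ContinuousLinearMap.precomp ℂ T

/-- The fixed point space `ker (T - I)`. -/
def fixedSpace {X : Type*} [NormedAddCommGroup X] [NormedSpace ℂ X]
    (T : X →L[ℂ] X) : Submodule ℂ X :=
  (T - ContinuousLinearMap.id ℂ X).ker

/-- `P` is a (bounded) finite-rank projection. -/
def IsFiniteRankProjection {X : Type*} [NormedAddCommGroup X] [NormedSpace ℂ X]
    (P : X →L[ℂ] X) : Prop :=
  IsIdempotentElem P ∧ FiniteDimensional ℂ P.range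

/-- The synthesis operator `Φ : ℂⁿ → X`, `Φ a = ∑ i, a i • e i`. -/
noncomputable def synthesisOp {X : Type*} [NormedAddCommGroup X] [NormedSpace ℂ X] {n : ℕ}
    (e : Fin n → X) : (Fin n → ℂ) →L[ℂ] X :=
  ∑ i, (ContinuousLinearMap.proj (R := ℂ) (φ := fun _ : Fin n => ℂ) i).smulRight (e i)

/-- The analysis operator `Φ* : X → ℂⁿ`, `Φ* x = (f 1 x, …, f n x)`. -/
noncomputable def analysisOp {X : Type*} [NormedAddCommGroup X] [NormedSpace ℂ X] {n : ℕ}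
    (f : Fin n → StrongDual ℂ X) : X →L[ℂ] (Fin n → ℂ) :=
  ContinuousLinearMap.pi f

/-- The Gram matrix `G = Φ*Φ`, with entry `f i (e j)` in row `i` and column `j`. -/
noncomputable def gramianMatrix {X : Type*} [NormedAddCommGroup X] [NormedSpace ℂ X] {n : ℕ}
    (e : Fin n → X) (f : Fin n → StrongDual ℂ X) : Matrix (Fin n) (Fin n) ℂ :=
  Matrix.of fun i j => f i (e j)

/-- The operator `Φ G⁻¹ Φ*` (meaningful when `G` is invertible). -/
noncomputable def gramianOp {X : Type*} [NormedAddCommGroup X] [NormedSpace ℂ X] {n : ℕ}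
    (e : Fin n → X) (f : Fin n → StrongDual ℂ X) : X →L[ℂ] X :=
  synthesisOp e ∘L LinearMap.toContinuousLinearMap (gramianMatrix e f)⁻¹.mulVecLin ∘L analysisOp f

/-! Everything happens at the eigenvalue 1. Quasi-compactness makes D = T - I Fredholm of index 0,
and a contraction has no generalized fixed vectors, so ker D meets ran D trivially; equality of
dimensions then gives X = ker D ⊕ ran D. For the projection P onto ker D along ran D, passing from T
to T - P removes 1 from the spectrum, so r(T - P) < 1 and T^m - P = (T - P)^m → 0 for m ≥ 1.
Conversely, convergence gives r(T - P) < 1, and `isWeylOperator_sub_id` handles the point 1.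

For the Gram formula, ran P is the fixed space of T, and the fixed functionals of T* are those with
f ∘ P = f, that is, the dual of ran P. Bases of the two spaces therefore pair nondegenerately. -/

/-! ### Idempotents, powers and spectral radius in algebras -/

/-- Splitting off an idempotent `p` on which `t` acts as the identity changes the spectrum at most
at `0` and `1`. -/
theorem isUnit_algebraMap_sub_iff_of_idempotent {A : Type*} [Ring A] [Algebra ℂ A] {t p : A}
    (hp : p * p = p) (htp : t * p = p) {z : ℂ} (h0 : z ≠ 0) (h1 : z ≠ 1) :
    IsUnit (algebraMap ℂ A z - t) ↔ IsUnit (algebraMap ℂ A z - (t - p)) := by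
  have h1' : z - 1 ≠ 0 := sub_ne_zero.2 h1
  have key : algebraMap ℂ A z - t = (algebraMap ℂ A z - (t - p)) * (1 - z⁻¹ • p) := by
    have : (algebraMap ℂ A z - (t - p)) * (z⁻¹ • p) = p := by
      rw [mul_smul_comm, sub_mul, sub_mul, htp, hp, sub_self, sub_zero, ← Algebra.smul_def,
        smul_smul, inv_mul_cancel₀ h0, one_smul]
    rw [mul_sub, this, mul_one]
    abel
  have hmul (a b : ℂ) (hab : b - a - a * b = 0) : (1 - a • p) * (1 + b • p) = 1 := by
    have : (1 - a • p) * (1 + b • p) = 1 + (b - a - a * b) • p := by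
      simp only [sub_mul, mul_add, mul_one, one_mul, smul_mul_smul_comm, hp, sub_smul]
      abel
    rw [this, hab, zero_smul, add_zero]
  have hu : IsUnit (1 - z⁻¹ • p) := by
    -- With a = 1/z, the equation b - a - ab = 0 gives b = a/(1 - a) = 1/(z - 1).
    refine ⟨⟨1 - z⁻¹ • p, 1 + (z - 1)⁻¹ • p, hmul _ _ ?_, ?_⟩, rfl⟩
    · field_simp
      ring
    · have := hmul (-(z - 1)⁻¹) (-z⁻¹) (by field_simp; ring)
      simpa only [neg_smul, sub_neg_eq_add, ← sub_eq_add_neg] using this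
  obtain ⟨u, hu⟩ := hu
  rw [key, ← hu, Units.isUnit_mul_units]

/-- The exponent starts at 1 because at 0 the two sides are 1 and 1 - p. -/
theorem sub_pow_of_mul_eq {A : Type*} [Ring A] {t p : A} (hp : p * p = p) (htp : t * p = p)
    (hpt : p * t = p) (n : ℕ) : (t - p) ^ (n + 1) = t ^ (n + 1) - p := by
  have hpow (n : ℕ) : t ^ n * p = p := by
    induction n with
    | zero => simp
    | succ k ih => rw [pow_succ, mul_assoc, htp, ih]
  induction n with
  | zero => simp
  | succ k ih =>
    rw [pow_succ, ih, sub_mul, mul_sub, mul_sub, hpow, hpt, hp, ← pow_succ, sub_self, sub_zero]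

/-- By Gelfand's formula, ‖a ^ n‖ ≤ r ^ n eventually, for some r < 1. -/
theorem tendsto_norm_pow_of_spectralRadius_lt_one {A : Type*} [NormedRing A] [NormedAlgebra ℂ A]
    [CompleteSpace A] {a : A} (ha : spectralRadius ℂ a < 1) :
    Tendsto (fun n : ℕ => ‖a ^ n‖) atTop (𝓝 0) := by
  obtain ⟨r, har, hr1⟩ := ENNReal.lt_iff_exists_nnreal_btwn.1 ha
  have hr1' : r < 1 := mod_cast hr1
  have hev := (spectrum.pow_nnnorm_pow_one_div_tendsto_nhds_spectralRadius a).eventually_lt_const har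
  refine squeeze_zero' (Eventually.of_forall fun _ => norm_nonneg _) ?_
    (tendsto_pow_atTop_nhds_zero_of_lt_one r.coe_nonneg hr1')
  filter_upwards [hev, eventually_gt_atTop 0] with n hn hpos
  have h := ENNReal.rpow_le_rpow hn.le (Nat.cast_nonneg (α := ℝ) n)
  rw [← ENNReal.rpow_mul, one_div, inv_mul_cancel₀ (by positivity), ENNReal.rpow_one,
    ENNReal.rpow_natCast] at h
  exact mod_cast h

theorem spectralRadius_lt_one_of_norm_pow_lt_one {A : Type*} [NormedRing A] [NormedAlgebra ℂ A]
    [CompleteSpace A] [NormOneClass A] {a : A} {n : ℕ} (h : ‖a ^ (n + 1)‖ < 1) :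
    spectralRadius ℂ a < 1 := by
  refine (spectrum.spectralRadius_le_pow_nnnorm_pow_one_div ℂ a n).trans_lt ?_
  have h' : (‖a ^ (n + 1)‖₊ : ENNReal) < 1 := mod_cast h
  simpa using ENNReal.rpow_lt_one h' (by positivity : (0 : ℝ) < 1 / (n + 1))

/-! ### Fixed vectors and Weyl operators -/

section
variable {X : Type*} [NormedAddCommGroup X] [NormedSpace ℂ X]

theorem mem_fixedSpace {T : X →L[ℂ] X} {x : X} : x ∈ fixedSpace T ↔ T x = x := by
  simp [fixedSpace, sub_eq_zero]

theorem mem_fixedSpace_dualAdjoint {T : X →L[ℂ] X} {f : StrongDual ℂ X} :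
    f ∈ fixedSpace (dualAdjoint T) ↔ f ∘L T = f :=
  mem_fixedSpace

theorem pow_apply_of_fixed {T : X →L[ℂ] X} {x : X} (hx : T x = x) (n : ℕ) : (T ^ n) x = x := by
  induction n with
  | zero => simp
  | succ k ih => rw [pow_succ, mul_apply_eq_comp, hx, ih]

/-- A contraction has no generalized fixed vectors. -/
theorem fixedSpace_disjoint_range {T : X →L[ℂ] X} (hT : ‖T‖ ≤ 1) :
    Disjoint (fixedSpace T) (T - ContinuousLinearMap.id ℂ X).range := by
  rw [Submodule.disjoint_def]
  rintro y hy ⟨x, rfl⟩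
  set y := (T - ContinuousLinearMap.id ℂ X) x with hydef
  replace hy : T y = y := mem_fixedSpace.1 hy
  have hTx : T x = x + y := by simp [hydef]
  -- A Jordan chain at 1 forces linear growth of the orbit of x, which a contraction forbids.
  have hpow (n : ℕ) : (T ^ n) x = x + (n : ℂ) • y := by
    induction n with
    | zero => simp
    | succ k ih =>
      rw [pow_succ', mul_apply_eq_comp, ih, map_add, map_smul, hy, hTx]
      push_cast
      module
  have hcontr (n : ℕ) : ‖(T ^ n) x‖ ≤ ‖x‖ := by
    induction n with
    | zero => simp
    | succ k ih =>
      rw [pow_succ', mul_apply_eq_comp]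
      exact (T.le_of_opNorm_le hT _).trans (by simpa using ih)
  have hbound (n : ℕ) : n * ‖y‖ ≤ 2 * ‖x‖ := by
    calc n * ‖y‖ = ‖(T ^ n) x - x‖ := by simp [hpow, norm_smul]
      _ ≤ ‖(T ^ n) x‖ + ‖x‖ := norm_sub_le _ _
      _ ≤ 2 * ‖x‖ := by linarith [hcontr n]
  by_contra hne
  replace hne : y ≠ 0 := hne
  obtain ⟨n, hn⟩ := exists_nat_gt (2 * ‖x‖ / ‖y‖)
  rw [div_lt_iff₀ (norm_pos_iff.2 hne)] at hn
  exact absurd (hbound n) hn.not_ge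

theorem IsQuasiCompactOperator.isWeylOperator_sub_id {T : X →L[ℂ] X}
    (h : IsQuasiCompactOperator T) : IsWeylOperator (T - ContinuousLinearMap.id ℂ X) := by
  by_contra hW
  have h1 : (1 : ℂ) ∈ essentialSpectrum T := by
    change ¬ IsWeylOperator (T - (1 : ℂ) • ContinuousLinearMap.id ℂ X)
    rwa [one_smul]
  have h2 : (‖(1 : ℂ)‖₊ : ENNReal) ≤ essentialSpectralRadius T :=
    le_iSup₂ (f := fun (z : ℂ) (_ : z ∈ essentialSpectrum T) => (‖z‖₊ : ENNReal)) 1 h1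
  rw [nnnorm_one, ENNReal.coe_one] at h2
  exact h2.not_gt h

theorem IsUnit.isWeylOperator {U : X →L[ℂ] X} (hU : IsUnit U) : IsWeylOperator U := by
  obtain ⟨u, rfl⟩ := hU
  let e := ContinuousLinearEquiv.unitsEquiv ℂ X u
  exact ⟨.of_isQuasiInverse (v := (e.symm : X →L[ℂ] X)) e.toLinearEquiv.isQuasiInverse,
    e.toLinearEquiv.index_eq_zero⟩

/-- `T - I` is a Weyl operator as soon as `I - (T - P)` is invertible for some finite-rank
projection `P` with `TP = PT = P`. -/
theorem isWeylOperator_sub_id {T P : X →L[ℂ] X} (hP : IsFiniteRankProjection P) (hTP : T * P = P)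
    (hPT : P * T = P) (hu : IsUnit (1 - (T - P))) :
    IsWeylOperator (T - ContinuousLinearMap.id ℂ X) := by
  obtain ⟨hidem, hfin⟩ := hP
  replace hidem : P * P = P := hidem
  obtain ⟨u, hu⟩ := hu
  have hD : T - ContinuousLinearMap.id ℂ X = P - u := by
    rw [hu, ContinuousLinearMap.one_def]; abel
  have hPu : P * u = P := by rw [hu, mul_sub, mul_sub, hPT, hidem, mul_one, sub_self, sub_zero]
  have huP : u * P = P := by rw [hu, sub_mul, sub_mul, hTP, hidem, one_mul, sub_self, sub_zero]
  have hPv : P * ↑u⁻¹ = P := by rw [Units.mul_inv_eq_iff_eq_mul, hPu]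
  have hvP : ↑u⁻¹ * P = P := by rw [Units.inv_mul_eq_iff_eq_mul, huP]
  rw [hD]
  -- -u⁻¹ inverts T - I = P - u up to the finite-rank error -P.
  have hl : -(↑u⁻¹ : X →L[ℂ] X) * (P - u) - 1 = -P := by
    rw [mul_sub, neg_mul, neg_mul, hvP, Units.inv_mul]; abel
  have hr : (P - u) * -(↑u⁻¹ : X →L[ℂ] X) - 1 = -P := by
    rw [sub_mul, mul_neg, mul_neg, hPv, Units.mul_inv]; abel
  have hfr : (P : X →ₗ[ℂ] X).HasFiniteRange := LinearMap.hasFiniteRange_iff_range.2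
    (Module.finite_def.1 hfin |> (Submodule.fg_top _).1)
  have hPP (x : X) : P (P x) = P x := by rw [← mul_apply_eq_comp, hidem]
  have huPx (x : X) : (u : X →L[ℂ] X) (P x) = P x := by rw [← mul_apply_eq_comp, huP]
  have hPux (x : X) : P ((u : X →L[ℂ] X) x) = P x := by rw [← mul_apply_eq_comp, hPu]
  have hvPx (x : X) : (↑u⁻¹ : X →L[ℂ] X) (P x) = P x := by
    rw [← mul_apply_eq_comp, hvP]
  have hPvx (x : X) : P ((↑u⁻¹ : X →L[ℂ] X) x) = P x := by
    rw [← mul_apply_eq_comp, hPv]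
  have huv (x : X) : (u : X →L[ℂ] X) ((↑u⁻¹ : X →L[ℂ] X) x) = x := by
    rw [← mul_apply_eq_comp, Units.mul_inv, one_apply_eq_self]
  have hvu (x : X) : (↑u⁻¹ : X →L[ℂ] X) ((u : X →L[ℂ] X) x) = x := by
    rw [← mul_apply_eq_comp, Units.inv_mul, one_apply_eq_self]
  have hker : (P - u : X →L[ℂ] X).ker = P.range := by
    ext x
    constructor
    · intro hx
      have hx : P x - (u : X →L[ℂ] X) x = 0 := hx
      refine ⟨x, ?_⟩
      rw [sub_eq_zero] at hx
      have := congrArg (↑u⁻¹ : X →L[ℂ] X) hx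
      rwa [hvPx, hvu] at this
    · rintro ⟨y, rfl⟩
      change P (P y) - (u : X →L[ℂ] X) (P y) = 0
      rw [hPP, huPx, sub_self]
  have hrange : (P - u : X →L[ℂ] X).range = P.ker := by
    ext y
    constructor
    · rintro ⟨x, rfl⟩
      change P (P x - (u : X →L[ℂ] X) x) = 0
      rw [map_sub, hPP, hPux, sub_self]
    · intro hy
      have hy : P y = 0 := hy
      refine ⟨-(↑u⁻¹ : X →L[ℂ] X) y, ?_⟩
      change P (-(↑u⁻¹ : X →L[ℂ] X) y) - (u : X →L[ℂ] X) (-(↑u⁻¹ : X →L[ℂ] X) y) = y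
      rw [map_neg, map_neg, hPvx, huv, hy]
      simp
  refine ⟨.of_isQuasiInverse (v := -(↑u⁻¹ : X →L[ℂ] X)) ⟨?_, ?_⟩, ?_⟩
  · refine LinearMap.FiniteRangeSetoid.equiv_iff_hasFiniteRange.2 ?_
    have h := congrArg (fun A : X →L[ℂ] X => (A : X →ₗ[ℂ] X).HasFiniteRange) hl
    exact h.mpr hfr.neg
  · refine LinearMap.FiniteRangeSetoid.equiv_iff_hasFiniteRange.2 ?_
    have h := congrArg (fun A : X →L[ℂ] X => (A : X →ₗ[ℂ] X).HasFiniteRange) hr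
    exact h.mpr hfr.neg
  -- The kernel is ran P, and the cokernel X / ker P is isomorphic to ran P.
  · rw [LinearMap.index_eq_finrank_sub, hker, hrange,
      (P : X →ₗ[ℂ] X).quotKerEquivRange.finrank_eq, sub_self]

/-- Disjointness makes p → V ⧸ q injective, hence surjective by dimension. -/
theorem isCompl_of_disjoint_of_finrank_quotient {K V : Type*} [DivisionRing K] [AddCommGroup V]
    [Module K V] {p q : Submodule K V} [FiniteDimensional K p] [FiniteDimensional K (V ⧸ q)]
    (h : Disjoint p q) (hd : Module.finrank K p = Module.finrank K (V ⧸ q)) : IsCompl p q := by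
  let φ : p →ₗ[K] V ⧸ q := q.mkQ ∘ₗ p.subtype
  have hinj : Function.Injective φ := by
    rw [← LinearMap.ker_eq_bot, LinearMap.ker_comp, Submodule.ker_mkQ]
    exact Submodule.disjoint_iff_comap_eq_bot.1 h
  have hsurj := (LinearMap.injective_iff_surjective_of_finrank_eq_finrank hd).1 hinj
  refine ⟨h, codisjoint_iff.2 (eq_top_iff.2 fun x _ => ?_)⟩
  obtain ⟨y, hy⟩ := hsurj (q.mkQ x)
  have : x - y ∈ q := by
    rw [← Submodule.Quotient.mk_eq_zero, Submodule.Quotient.mk_sub, sub_eq_zero]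
    exact hy.symm
  exact Submodule.mem_sup.2 ⟨y, y.2, x - y, this, by simp⟩

end

/-! ### Quasi-compactness and convergence of powers -/

section
variable {X : Type*} [NormedAddCommGroup X] [NormedSpace ℂ X] [CompleteSpace X]

theorem exists_projection_of_isWeylOperator [Nontrivial X] {T : X →L[ℂ] X} (hT : ‖T‖ ≤ 1)
    (hspec : spectrum ℂ T ⊆ Metric.ball (0 : ℂ) 1 ∪ {1})
    (hW : IsWeylOperator (T - ContinuousLinearMap.id ℂ X)) :
    ∃ P : X →L[ℂ] X, IsFiniteRankProjection P ∧ T ∘L P = P ∧ P ∘L T = P ∧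
      Tendsto (fun m : ℕ => ‖T ^ m - P‖) atTop (𝓝 0) := by
  obtain ⟨hF, hI⟩ := hW
  set D := T - ContinuousLinearMap.id ℂ X with hD
  have := hF.finite_ker
  have : FiniteDimensional ℂ (X ⧸ D.range) := hF.finite_coker
  have hdim : Module.finrank ℂ D.ker = Module.finrank ℂ (X ⧸ D.range) := by
    rw [LinearMap.index_eq_finrank_sub] at hI
    exact_mod_cast sub_eq_zero.1 hI
  have hcompl : IsCompl D.ker D.range :=
    isCompl_of_disjoint_of_finrank_quotient (fixedSpace_disjoint_range hT) hdim
  have htop := Submodule.IsCompl.isTopCompl_of_isClosed hcompl D.isClosed_ker hF.isClosed_range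
  set P := D.ker.projectionL D.range htop with hP
  have hPker (x : X) : D (P x) = 0 := Submodule.projectionL_apply_mem htop x
  have hPD (x : X) : P (D x) = 0 :=
    Submodule.projectionL_apply_right htop ⟨D x, LinearMap.mem_range_self _ x⟩
  have hidem : P * P = P := Submodule.isIdempotentElem_projectionL htop
  have hTP : T * P = P := by
    ext x
    simpa [hD, sub_eq_zero] using hPker x
  have hPT : P * T = P := by
    ext x
    simpa [hD, sub_eq_zero] using hPD x
  have hrange : P.range = D.ker := Submodule.range_projectionL htop
  refine ⟨P, ⟨hidem, by rwa [hrange]⟩, hTP, hPT, ?_⟩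
  have hone : IsUnit (1 - (T - P)) := by
    rw [ContinuousLinearMap.isUnit_iff_bijective]
    have happ (x : X) : (1 - (T - P)) x = P x - D x := by simp [hD]; abel
    constructor
    · rw [injective_iff_map_eq_zero]
      intro x hx
      rw [happ] at hx
      have h1 : P x = 0 := by
        have := congrArg P hx
        rwa [map_sub, hPD, sub_zero, map_zero, ← mul_apply_eq_comp, hidem] at this
      have h2 : x ∈ D.ker := by simpa [h1] using hx
      have h3 : P x = x := Submodule.projectionL_apply_left htop ⟨x, h2⟩
      rw [← h3, h1]
    · intro y
      obtain ⟨u, hu, v, ⟨w, rfl⟩, rfl⟩ :=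
        Submodule.mem_sup.1 (hcompl.sup_eq_top ▸ Submodule.mem_top : y ∈ D.ker ⊔ D.range)
      -- P - D is the identity on ker D and -D on ran D = ker P; subtracting P w moves w into ker P
      -- without changing D w.
      refine ⟨u - (w - P w), ?_⟩
      have h3 : P u = u := Submodule.projectionL_apply_left htop ⟨u, hu⟩
      have h4 : P (P w) = P w := by rw [← mul_apply_eq_comp, hidem]
      have h5 : D u = 0 := hu
      rw [happ]
      simp [map_sub, h3, h4, h5, hPker]
  have hrad : spectralRadius ℂ (T - P) < 1 := by
    refine mod_cast spectrum.spectralRadius_lt_of_forall_lt (r := 1) (T - P) fun z hz => ?_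
    by_contra! hz1
    have hz1 : 1 ≤ ‖z‖ := hz1
    have h0 : z ≠ 0 := norm_pos_iff.1 (by linarith)
    refine hz ?_
    rw [spectrum.mem_resolventSet_iff]
    rcases eq_or_ne z 1 with rfl | h1
    · simpa using hone
    · rw [← isUnit_algebraMap_sub_iff_of_idempotent hidem hTP h0 h1]
      by_contra hu
      rcases hspec (show z ∈ spectrum ℂ T from hu) with h | h
      · rw [mem_ball_zero_iff] at h
        linarith
      · exact h1 h
  refine (tendsto_norm_pow_of_spectralRadius_lt_one hrad).congr' ?_
  filter_upwards [eventually_gt_atTop 0] with n hn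
  obtain ⟨k, rfl⟩ := Nat.exists_eq_succ_of_ne_zero hn.ne'
  rw [Nat.succ_eq_add_one, sub_pow_of_mul_eq hidem hTP hPT]

/-- The bound is r_ess(T) ≤ r(T - P): if |z| > r(T - P), then T - z is invertible for z ≠ 1 and Weyl
for z = 1. -/
theorem isQuasiCompactOperator_of_tendsto [Nontrivial X] {T P : X →L[ℂ] X}
    (hP : IsFiniteRankProjection P) (hTP : T * P = P) (hPT : P * T = P)
    (hlim : Tendsto (fun m : ℕ => ‖T ^ m - P‖) atTop (𝓝 0)) : IsQuasiCompactOperator T := by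
  have hidem : P * P = P := hP.1
  have hrad : spectralRadius ℂ (T - P) < 1 := by
    obtain ⟨n, hn⟩ :=
      (((tendsto_add_atTop_iff_nat 1).2 hlim).eventually_lt_const one_pos).exists
    exact spectralRadius_lt_one_of_norm_pow_lt_one (n := n)
      (by rwa [sub_pow_of_mul_eq hidem hTP hPT])
  refine lt_of_le_of_lt (iSup₂_le fun z hz => ?_) hrad
  by_contra! hlt
  refine hz ?_
  have hu : IsUnit (algebraMap ℂ (X →L[ℂ] X) z - (T - P)) :=
    spectrum.mem_resolventSet_iff.1 (spectrum.mem_resolventSet_of_spectralRadius_lt hlt)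
  have h0 : z ≠ 0 := by
    rintro rfl
    simp at hlt
  rcases eq_or_ne z 1 with rfl | h1
  · rw [one_smul]
    exact isWeylOperator_sub_id hP hTP hPT (by simpa using hu)
  · rw [← isUnit_algebraMap_sub_iff_of_idempotent hidem hTP h0 h1] at hu
    have : T - z • ContinuousLinearMap.id ℂ X = -(algebraMap ℂ (X →L[ℂ] X) z - T) := by
      rw [neg_sub, Algebra.algebraMap_eq_smul_one, ContinuousLinearMap.one_def]
    rw [this]
    exact hu.neg.isWeylOperator

end

/-! ### Fixed functionals and the Gram matrix -/

section
variable {X : Type*} [NormedAddCommGroup X] [NormedSpace ℂ X]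

theorem range_eq_fixedSpace_of_tendsto {T P : X →L[ℂ] X} (hTP : T ∘L P = P)
    (hlim : Tendsto (fun m : ℕ => T ^ m) atTop (𝓝 P)) : P.range = fixedSpace T := by
  ext x
  rw [mem_fixedSpace]
  constructor
  · rintro ⟨y, rfl⟩
    exact congrArg (· y) hTP
  · intro hx
    have h := ((ContinuousLinearMap.apply ℂ X x).continuous.tendsto P).comp hlim
    refine ⟨x, tendsto_nhds_unique h (tendsto_const_nhds.congr fun m => ?_)⟩
    exact (pow_apply_of_fixed hx m).symm

theorem mem_fixedSpace_dualAdjoint_iff_of_tendsto {T P : X →L[ℂ] X} (hPT : P ∘L T = P)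
    (hlim : Tendsto (fun m : ℕ => T ^ m) atTop (𝓝 P)) {f : StrongDual ℂ X} :
    f ∈ fixedSpace (dualAdjoint T) ↔ f ∘L P = f := by
  rw [mem_fixedSpace_dualAdjoint]
  constructor
  · intro hf
    have hpow (m : ℕ) : f ∘L (T ^ m) = f := by
      induction m with
      | zero => rfl
      | succ k ih =>
        rw [pow_succ]
        exact (congrArg (· ∘L T) ih).trans hf
    have h : Tendsto (fun m : ℕ => f ∘L (T ^ m)) atTop (𝓝 (f ∘L P)) :=
      ((ContinuousLinearMap.compL ℂ X X ℂ f).continuous.tendsto P).comp hlim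
    simp only [hpow] at h
    exact tendsto_nhds_unique h tendsto_const_nhds
  · intro hf
    rw [← hf, ContinuousLinearMap.comp_assoc, hPT]

/-- The functionals `f` with `f ∘ P = f` are the dual of the range of the projection `P`. -/
noncomputable def fixedDualEquiv {P : X →L[ℂ] X} (hP : IsIdempotentElem P)
    (V : Submodule ℂ (StrongDual ℂ X)) (hV : ∀ f, f ∈ V ↔ f ∘L P = f) :
    V ≃ₗ[ℂ] StrongDual ℂ P.range where
  toFun f := (f : StrongDual ℂ X) ∘L P.range.subtypeL
  map_add' _ _ := rfl
  map_smul' _ _ := rfl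
  invFun g := ⟨g ∘L P.codRestrict P.range fun x => LinearMap.mem_range_self _ x, by
    rw [hV, ContinuousLinearMap.comp_assoc]
    congr 1
    ext x
    exact congrArg (· x) hP.eq⟩
  left_inv f := by
    ext x
    exact congrArg (· x) ((hV f).1 f.2)
  right_inv g := by
    ext ⟨_, y, rfl⟩
    refine congrArg g (Subtype.ext ?_)
    exact congrArg (· y) hP.eq

theorem synthesisOp_apply {n : ℕ} (e : Fin n → X) (a : Fin n → ℂ) :
    synthesisOp e a = ∑ i, a i • e i := by
  simp [synthesisOp]

theorem gramianOp_apply {n : ℕ} (e : Fin n → X) (f : Fin n → StrongDual ℂ X) (x : X) :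
    gramianOp e f x =
      synthesisOp e ((gramianMatrix e f)⁻¹.mulVec (analysisOp f x)) := rfl

theorem analysisOp_synthesisOp {n : ℕ} (e : Fin n → X) (f : Fin n → StrongDual ℂ X)
    (a : Fin n → ℂ) : analysisOp f (synthesisOp e a) = (gramianMatrix e f).mulVec a := by
  ext i
  simp [analysisOp, synthesisOp_apply, gramianMatrix, Matrix.mulVec, dotProduct, mul_comm]

theorem gramianOp_synthesisOp {n : ℕ} {e : Fin n → X} {f : Fin n → StrongDual ℂ X}
    (hG : IsUnit (gramianMatrix e f)) (a : Fin n → ℂ) :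
    gramianOp e f (synthesisOp e a) = synthesisOp e a := by
  rw [gramianOp_apply, analysisOp_synthesisOp, Matrix.mulVec_mulVec,
    Matrix.nonsing_inv_mul _ ((Matrix.isUnit_iff_isUnit_det _).1 hG), Matrix.one_mulVec]

/-- If `e` is a basis of the range of the projection `P` and `f` is a basis of the functionals
fixed by `P`, then the Gram matrix is invertible and `P = Φ G⁻¹ Φ*`. -/
theorem gramianOp_eq_projection {P : X →L[ℂ] X} (hP : IsIdempotentElem P) {V : Submodule ℂ X}
    (hV : P.range = V) {W : Submodule ℂ (StrongDual ℂ X)} (hW : ∀ f, f ∈ W ↔ f ∘L P = f) {n : ℕ}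
    (e : Module.Basis (Fin n) ℂ V) (f : Module.Basis (Fin n) ℂ W) :
    IsUnit (gramianMatrix (fun i => (e i : X)) (fun i => (f i : StrongDual ℂ X))) ∧
      P = gramianOp (fun i => (e i : X)) (fun i => (f i : StrongDual ℂ X)) := by
  set e' : Fin n → X := fun i => (e i : X)
  set f' : Fin n → StrongDual ℂ X := fun i => (f i : StrongDual ℂ X)
  have hPP (x : X) : P (P x) = P x := congrArg (· x) hP.eq
  have hsyn (a : Fin n → ℂ) : synthesisOp e' a = (e.equivFun.symm a : V) := by
    simp [synthesisOp_apply, Module.Basis.equivFun_symm_apply, e']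
  have hPsyn (a : Fin n → ℂ) : P (synthesisOp e' a) = synthesisOp e' a := by
    have : synthesisOp e' a ∈ P.range := by
      rw [hV, hsyn]
      exact Subtype.coe_prop _
    obtain ⟨y, hy⟩ := this
    rw [← hy]
    exact hPP y
  have hspan (x : X) (hx : ∀ i, f' i x = 0) (g : StrongDual ℂ X) (hg : g ∈ W) : g x = 0 := by
    have := congrArg (fun h : W => (h : StrongDual ℂ X) x) (f.sum_repr ⟨g, hg⟩)
    simp only [Submodule.coe_sum, Submodule.coe_smul, sum_apply,
      smul_apply] at this
    rw [← this]
    exact Finset.sum_eq_zero fun i _ => by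
      rw [show (f i : StrongDual ℂ X) x = 0 from hx i, smul_zero]
  have hG : IsUnit (gramianMatrix e' f') := by
    rw [← Matrix.mulVec_injective_iff_isUnit, ← Matrix.coe_mulVecLin, injective_iff_map_eq_zero]
    intro a ha
    rw [Matrix.mulVecLin_apply, ← analysisOp_synthesisOp] at ha
    have hzero : synthesisOp e' a = 0 := by
      -- Each g agrees with g ∘ P on the vector Φ a, and g ∘ P lies in W, whose basis kills Φ a;
      -- Hahn–Banach concludes.
      refine SeparatingDual.eq_zero_of_forall_dual_eq_zero (R := ℂ) fun g => ?_
      rw [← hPsyn]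
      refine hspan _ (fun i => congrFun ha i) (g ∘L P) ((hW _).2 ?_)
      rw [ContinuousLinearMap.comp_assoc]
      exact congrArg (g ∘L ·) hP.eq
    rw [hsyn, Submodule.coe_eq_zero] at hzero
    exact e.equivFun.symm.map_eq_zero_iff.1 hzero
  refine ⟨hG, ?_⟩
  ext x
  -- Since Φ* P = Φ*, the Gram operator sees only P x, and it fixes ran Φ.
  have h1 : analysisOp f' (P x) = analysisOp f' x := by
    ext i
    exact congrArg (· x) ((hW _).1 (f i).2)
  have h2 : P x ∈ V := hV ▸ LinearMap.mem_range_self _ x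
  have h3 : synthesisOp e' (e.equivFun ⟨P x, h2⟩) = P x := by rw [hsyn]; simp
  have h4 := gramianOp_synthesisOp hG (e.equivFun ⟨P x, h2⟩)
  rw [h3] at h4
  rw [← h4, gramianOp_apply, gramianOp_apply, h1]

end

theorem mainTheorem1 {X : Type*} [NormedAddCommGroup X] [NormedSpace ℂ X] [CompleteSpace X]
    (T : X →L[ℂ] X) (hr : spectralRadius ℂ T = 1) (hnorm : ‖T‖ = 1)
    (hspec : spectrum ℂ T ⊆ Metric.ball (0 : ℂ) 1 ∪ {1}) :
    (IsQuasiCompactOperator T ↔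
      ∃ P : X →L[ℂ] X, IsFiniteRankProjection P ∧ T ∘L P = P ∧ P ∘L T = P ∧
        Tendsto (fun m : ℕ => ‖T ^ m - P‖) atTop (𝓝 0)) ∧
    (IsQuasiCompactOperator T →
      FiniteDimensional ℂ (fixedSpace T) ∧
      FiniteDimensional ℂ (fixedSpace (dualAdjoint T)) ∧
      Module.finrank ℂ (fixedSpace T) = Module.finrank ℂ (fixedSpace (dualAdjoint T)) ∧
      ∀ (n : ℕ) (e : Module.Basis (Fin n) ℂ (fixedSpace T))
        (f : Module.Basis (Fin n) ℂ (fixedSpace (dualAdjoint T))),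
        IsUnit (gramianMatrix (fun i => (e i : X)) (fun i => (f i : StrongDual ℂ X))) ∧
        ∃ P : X →L[ℂ] X,
          P = gramianOp (fun i => (e i : X)) (fun i => (f i : StrongDual ℂ X)) ∧
          IsFiniteRankProjection P ∧ P.range = fixedSpace T ∧ T ∘L P = P ∧ P ∘L T = P ∧
          Tendsto (fun m : ℕ => ‖T ^ m - P‖) atTop (𝓝 0)) := by
  have : Nontrivial X := by
    by_contra h
    rw [not_nontrivial_iff_subsingleton] at h
    simp [Subsingleton.elim T 0] at hnorm
  have hforward (h : IsQuasiCompactOperator T) :=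
    exists_projection_of_isWeylOperator hnorm.le hspec h.isWeylOperator_sub_id
  refine ⟨⟨hforward, fun ⟨P, hP, hTP, hPT, hlim⟩ =>
    isQuasiCompactOperator_of_tendsto hP hTP hPT hlim⟩, fun h => ?_⟩
  obtain ⟨P, hP, hTP, hPT, hlim⟩ := hforward h
  have hlim' := tendsto_iff_norm_sub_tendsto_zero.2 hlim
  have hrange := range_eq_fixedSpace_of_tendsto hTP hlim'
  have hdual (f : StrongDual ℂ X) := mem_fixedSpace_dualAdjoint_iff_of_tendsto hPT hlim' (f := f)
  have := hP.2
  let φ := fixedDualEquiv hP.1 (fixedSpace (dualAdjoint T)) hdual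
  let ψ := (LinearMap.toContinuousLinearMap : (P.range →ₗ[ℂ] ℂ) ≃ₗ[ℂ] (P.range →L[ℂ] ℂ))
  refine ⟨hrange ▸ hP.2, (ψ.trans φ.symm).finiteDimensional, ?_, fun n e f => ?_⟩
  · rw [← (ψ.trans φ.symm).finrank_eq, Subspace.dual_finrank_eq, hrange]
  · obtain ⟨hG, hPeq⟩ := gramianOp_eq_projection hP.1 hrange hdual e f
    exact ⟨hG, P, hPeq, hP, hrange, hTP, hPT, hlim⟩
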